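/- A signed graph is a finite simple graph together with a sign $+1$ or $-1$ on each edge; its adjacency matrix has entry $\pm 1$ (the sign of the edge) at adjacent pairs and $0$ elsewhere, and it is bipartite if its underlying graph is bipartite. Let $\mu$ be an eigenvalue, of multiplicity $k$, of (the adjacency matrix of) a signed graph $\dot G$. A set $S$ of $k$ vertices such that $\mu$ is not an eigenvalue of the induced signed subgraph $\dot G-S$ is called a star set for $\mu$, and $\dot G-S$ is then called a star complement for $\mu$ in $\dot G$. Let $\mathcal N(\mathcal H)$ be the set of all positive integers $n$ that have at least one of the following forms: 1. $n=2^p$ with $p\ge 1$; 2. $n=2^p(q^h+1)$ with $p\ge 2$, $h\ge 1$ and $q$ a prime; 3. $n=2^p q(q+1)$ with $p\ge 2$ and $q\equiv 3 \pmod 4$ a prime; 4. $n=q+1$ with $q\equiv 3\pmod 4$ a prime power; 5. $n=2(q+1)$ with $q\equiv 1\pmod 4$ a prime power. **Theorem.** Let $s\ge 2$ be an integer, let $\mu$ be a real number with $\mu^2=s$, and let $\dot H$ be the edgeless graph of order $s$. Let $n$ be the maximum order of a signed bipartite graph that has $\dot H$ (up to isomorphism) as a star complement for the eigenvalue $\mu$.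 Then $$n=\begin{cases} s+1 & \text{if } s \text{ is odd},\\ s+2 & \text{if } s\equiv 2 \pmod 4,\\ 2s & \text{if } s\in\mathcal N(\mathcal H).\end{cases}$$ (In particular the maximum exists in each of these cases. The second and third cases overlap only for $s=2$, where they agree.) -/

import Mathlib

universe u v

/-- A signed graph on the vertex set `V`: a simple graph together with a sign `1` or `-1`
on each of its edges. -/
structure SignedGraph (V : Type u) where
  /-- The underlying simple graph. -/
  graph : SimpleGraph V
  /-- The sign function, defined on the edges. -/
  sign : graph.edgeSet → ℤˣ

namespace SignedGraph

/-- The edgeless (totally disconnected) signed graph on `V`. -/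
def edgeless (V : Type u) : SignedGraph V where
  graph := ⊥
  sign := fun _ => 1

/-- The signed subgraph induced by a set of vertices. -/
def induce {V : Type u} (G : SignedGraph V) (X : Set V) : SignedGraph X where
  graph := G.graph.induce X
  sign := fun e =>
    G.sign ((SimpleGraph.Embedding.induce (G := G.graph) X).mapEdgeSet e)

/-- Two signed graphs are isomorphic if there is an isomorphism of the underlying graphs that
preserves the signs of all edges. -/
def Isomorphic {V : Type u} {W : Type v} (G : SignedGraph V) (H : SignedGraph W) : Prop :=
  ∃ φ : G.graph ≃g H.graph, ∀ e : G.graph.edgeSet, H.sign (φ.mapEdgeSet e) = G.sign e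

/-- A signed graph is bipartite if its underlying graph is. -/
def Bipartite {V : Type u} (G : SignedGraph V) : Prop :=
  G.graph.IsBipartite

open Classical in
/-- The adjacency matrix: entry `±1` (the sign of the edge) for adjacent vertices, otherwise `0`. -/
noncomputable def adjMatrix {V : Type u} (G : SignedGraph V) : Matrix V V ℝ :=
  fun x y => if h : G.graph.Adj x y then ((G.sign ⟨s(x, y), h⟩ : ℤ) : ℝ) else 0

/-- The adjacency matrix as a linear operator on `ℝ^V`. -/
noncomputable def adjOp {V : Type u} [Fintype V] (G : SignedGraph V) :
    Module.End ℝ (V → ℝ) :=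
  G.adjMatrix.mulVecLin

/-- `μ` is an eigenvalue of `G`. -/
def HasEigenvalue {V : Type u} [Fintype V] (G : SignedGraph V) (μ : ℝ) : Prop :=
  Module.End.HasEigenvalue G.adjOp μ

/-- The multiplicity of `μ` as an eigenvalue of `G`, i.e. the dimension of its eigenspace
(the adjacency matrix is real symmetric). -/
noncomputable def multiplicity {V : Type u} [Fintype V] (G : SignedGraph V) (μ : ℝ) : ℕ :=
  Module.finrank ℝ (Module.End.eigenspace G.adjOp μ)

open Classical in
/-- `S` is a star set for the eigenvalue `μ` of `G`: its size is the multiplicity of `μ`, and `μ`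
is not an eigenvalue of the signed graph obtained by deleting `S`. -/
def IsStarSet {V : Type u} [Fintype V] (G : SignedGraph V) (μ : ℝ) (S : Set V) : Prop :=
  G.HasEigenvalue μ ∧ S.ncard = G.multiplicity μ ∧ ¬ (G.induce Sᶜ).HasEigenvalue μ

/-- `G` has (a copy of) `H` as a star complement for the eigenvalue `μ`. -/
def HasStarComplement {V : Type u} {W : Type v} [Fintype V] (G : SignedGraph V)
    (H : SignedGraph W) (μ : ℝ) : Prop :=
  ∃ S : Set V, G.IsStarSet μ S ∧ (G.induce Sᶜ).Isomorphic H

/-- The set of orders of finite signed bipartite graphs that have `H` as a star complement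
for the eigenvalue `μ`. -/
def bipartiteOrders {W : Type v} (H : SignedGraph W) (μ : ℝ) : Set ℕ :=
  {n | ∃ (V : Type u) (_ : Fintype V) (G : SignedGraph V),
    Fintype.card V = n ∧ G.Bipartite ∧ G.HasStarComplement H μ}

end SignedGraph

/-- The set of all positive integers of one of the following five forms (each of which is
the order of a Hadamard matrix). -/
def hadamardOrders : Set ℕ :=
  {n |
    (∃ p : ℕ, 1 ≤ p ∧ n = 2 ^ p) ∨
    (∃ p h q : ℕ, 2 ≤ p ∧ 1 ≤ h ∧ q.Prime ∧ n = 2 ^ p * (q ^ h + 1)) ∨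
    (∃ p q : ℕ, 2 ≤ p ∧ q.Prime ∧ q % 4 = 3 ∧ n = 2 ^ p * q * (q + 1)) ∨
    (∃ q : ℕ, IsPrimePow q ∧ q % 4 = 3 ∧ n = q + 1) ∨
    (∃ q : ℕ, IsPrimePow q ∧ q % 4 = 1 ∧ n = 2 * (q + 1))}

/-! Let `S` be the star set, `T` its edgeless complement with `s` vertices, and `N` the matrix of
signs between `S` and `T`. Restriction to `S` is a bijection from the eigenspace onto `ℝ^S`; this
gives `μ A_S + N Nᵀ = μ² I` (`IsStarSet.reconstruction`). The diagonal says that each vertex of `S`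
has `μ² = s` neighbours in `T`, hence is joined to all of `T`. Bipartiteness then forces `A_S = 0`,
so the rows of `N` are pairwise orthogonal sign vectors of length `s`. Conversely, `k ≥ 1` such rows
give a signed complete bipartite graph of order `s + k` (`ofSigns_hasStarComplement`).

The maximum order is therefore `s` plus the largest number of pairwise orthogonal sign vectors of
length `s`. Two of them force `s` even, three force `4 ∣ s`, and linear independence allows at most
`s`, with equality exactly when a Hadamard matrix of order `s` exists. Most of the work is
`IsHadamardOrder.of_mem_hadamardOrders`, which builds these matrices: Sylvester doubling, Scarpis,
the two Paley constructions, and, for `4 (2^h + 1)`, the Goethals–Seidel array fed with Golay pairs.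
-/

/-- The rows of `M` are pairwise orthogonal vectors with entries `1` and `-1`. -/
structure OrthogonalSigns {ι κ : Type*} [Fintype κ] (M : ι → κ → ℤ) : Prop where
  entry : ∀ i j, M i j = 1 ∨ M i j = -1
  orthogonal : ∀ i i', i ≠ i' → ∑ j, M i j * M i' j = 0

/-- There is a Hadamard matrix of order `n`. -/
def IsHadamardOrder (n : ℕ) : Prop :=
  ∃ M : Fin n → Fin n → ℤ, OrthogonalSigns M

/-! ### Bounds on the number of pairwise orthogonal sign vectors. -/

namespace OrthogonalSigns

variable {ι κ : Type*} [Fintype κ] {M : ι → κ → ℤ}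

theorem mul_self (h : OrthogonalSigns M) (i : ι) (j : κ) : M i j * M i j = 1 := by
  rcases h.entry i j with h | h <;> simp [h]

theorem comp {ι' κ' : Type*} [Fintype κ'] (h : OrthogonalSigns M) (f : ι' → ι)
    (hf : Function.Injective f) (e : κ' ≃ κ) : OrthogonalSigns fun i j => M (f i) (e j) where
  entry _ _ := h.entry _ _
  orthogonal i i' hii := by
    rw [e.sum_comp fun j => M (f i) j * M (f i') j]
    exact h.orthogonal _ _ (hf.ne hii)

theorem isHadamardOrder [Fintype ι] (h : OrthogonalSigns M) {n : ℕ}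
    (hι : Fintype.card ι = n) (hκ : Fintype.card κ = n) : IsHadamardOrder n :=
  ⟨_, h.comp _ (Fintype.equivFinOfCardEq hι).symm.injective (Fintype.equivFinOfCardEq hκ).symm⟩

theorem card_le_card [Fintype ι] [Nonempty κ] (h : OrthogonalSigns M) :
    Fintype.card ι ≤ Fintype.card κ := by
  have hli : LinearIndependent ℚ fun i : ι => fun j : κ => (M i j : ℚ) := by
    rw [Fintype.linearIndependent_iff]
    intro g hg i
    have h1 : ∑ j, (∑ i', g i' * (M i' j : ℚ)) * M i j = 0 := by
      refine Finset.sum_eq_zero fun j _ => ?_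
      have := congrFun hg j
      simp only [Finset.sum_apply, Pi.smul_apply, smul_eq_mul, Pi.zero_apply] at this
      rw [this, zero_mul]
    simp_rw [Finset.sum_mul, mul_assoc] at h1
    rw [Finset.sum_comm] at h1
    simp_rw [← Finset.mul_sum] at h1
    rw [Finset.sum_eq_single i] at h1
    · have h2 : ∑ j, (M i j : ℚ) * M i j = Fintype.card κ := by
        have : ∀ j, (M i j : ℚ) * M i j = 1 := fun j => by exact_mod_cast h.mul_self i j
        simp [this]
      rw [h2] at h1
      have h3 : (Fintype.card κ : ℚ) ≠ 0 := by exact_mod_cast Fintype.card_ne_zero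
      exact (mul_eq_zero.mp h1).resolve_right h3
    · intro i' _ hi
      have : ∑ j, (M i' j : ℚ) * M i j = 0 := by exact_mod_cast h.orthogonal i' i hi
      rw [this, mul_zero]
    · simp
  simpa using hli.fintype_card_le_finrank

/-- Each product of two signs is `1` modulo `2`, so a vanishing inner product makes the length even.
-/
theorem even_card (h : OrthogonalSigns M) {a b : ι} (hab : a ≠ b) :
    Even (Fintype.card κ) := by
  have hdvd : (2 : ℤ) ∣ ∑ j, (M a j * M b j - 1) := Finset.dvd_sum fun j _ => by
    rcases h.entry a j with h1 | h1 <;> rcases h.entry b j with h2 | h2 <;> simp [h1, h2]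
  rw [Finset.sum_sub_distrib, h.orthogonal a b hab] at hdvd
  simp only [Finset.sum_const, Finset.card_univ, zero_sub, dvd_neg] at hdvd
  rw [even_iff_two_dvd]
  zify
  simpa using hdvd

/-- Every term `(a + b)(a + c)` is a multiple of `4`, while by orthogonality only `∑ a² = card κ`
survives in the expanded sum. -/
theorem four_dvd_card (h : OrthogonalSigns M) {a b c : ι} (hab : a ≠ b) (hac : a ≠ c)
    (hbc : b ≠ c) : 4 ∣ Fintype.card κ := by
  have hdvd : (4 : ℤ) ∣ ∑ j, (M a j + M b j) * (M a j + M c j) := Finset.dvd_sum fun j _ => by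
    rcases h.entry a j with h1 | h1 <;> rcases h.entry b j with h2 | h2 <;>
      rcases h.entry c j with h3 | h3 <;> simp [h1, h2, h3]
  have hexp : ∀ j, (M a j + M b j) * (M a j + M c j) =
      1 + M a j * M c j + M a j * M b j + M b j * M c j := fun j => by
    linear_combination h.mul_self a j
  simp_rw [hexp, Finset.sum_add_distrib, h.orthogonal a b hab, h.orthogonal a c hac,
    h.orthogonal b c hbc] at hdvd
  zify
  simpa using hdvd

/-- Normalizing a Hadamard matrix so that a prescribed row and column are constant. -/
theorem exists_normalized {α : Type*} [Fintype α] {M : α → α → ℤ} (h : OrthogonalSigns M)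
    (o : α) : ∃ N : α → α → ℤ, OrthogonalSigns N ∧ (∀ j, N o j = 1) ∧ ∀ i, N i o = 1 := by
  -- Column `j` is scaled by `M o j`, and then row `i` by its new entry in column `o`, which is `M i
  -- o * M o o`.
  refine ⟨fun i j => M i j * M o j * (M i o * M o o), ⟨fun i j => ?_, fun i i' hi => ?_⟩,
    fun j => ?_, fun i => ?_⟩
  · rcases h.entry i j with h1 | h1 <;> rcases h.entry o j with h2 | h2 <;>
      rcases h.entry i o with h3 | h3 <;> rcases h.entry o o with h4 | h4 <;>
      simp [h1, h2, h3, h4]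
  · have : ∀ j, M i j * M o j * (M i o * M o o) * (M i' j * M o j * (M i' o * M o o)) =
        (M i o * M i' o) * (M i j * M i' j) := fun j => by
      linear_combination (M i j * M i' j * M i o * M i' o * M o o * M o o) * h.mul_self o j +
        (M i j * M i' j * M i o * M i' o) * h.mul_self o o
    simp_rw [this]
    rw [← Finset.mul_sum, h.orthogonal i i' hi, mul_zero]
  · linear_combination h.mul_self o j + (M o j * M o j) * h.mul_self o o
  · linear_combination h.mul_self i o + (M i o * M i o) * h.mul_self o o

end OrthogonalSigns

/-! ### Constructions of Hadamard matrices: Sylvester, Scarpis, Paley, Goethals–Seidel. -/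

namespace IsHadamardOrder

theorem one : IsHadamardOrder 1 :=
  ⟨fun _ _ => 1, fun _ _ => Or.inl rfl, fun _ _ h => (h (Subsingleton.elim _ _)).elim⟩

/-- Sylvester doubling, with blocks `M, M; M, -M`. -/
theorem two_mul {n : ℕ} (hn : IsHadamardOrder n) : IsHadamardOrder (2 * n) := by
  obtain ⟨M, hM⟩ := hn
  refine OrthogonalSigns.isHadamardOrder (ι := Fin n ⊕ Fin n) (κ := Fin n ⊕ Fin n)
    (M := Sum.elim (fun i => Sum.elim (M i) (M i)) fun i => Sum.elim (M i) (-M i))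
    ⟨?_, ?_⟩ (by simp; ring) (by simp; ring)
  · rintro (i | i) (j | j) <;> rcases hM.entry i j with h | h <;> simp [h]
  · rintro (i | i) (i' | i') hi
    · have := hM.orthogonal i i' (by simpa using hi)
      simp [this]
    · simp
    · simp
    · have := hM.orthogonal i i' (by simpa using hi)
      simp [this]

theorem two_pow_mul {n : ℕ} (hn : IsHadamardOrder n) (p : ℕ) : IsHadamardOrder (2 ^ p * n) := by
  induction p with
  | zero => simpa using hn
  | succ p ih => rw [pow_succ', mul_assoc]; exact ih.two_mul

section FiniteField

variable {F : Type*} [Field F] [Fintype F]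

/-- Scarpis' construction. -/
theorem scarpis (hF : IsHadamardOrder (Fintype.card F + 1)) :
    IsHadamardOrder (Fintype.card F * (Fintype.card F + 1)) := by
  classical
  obtain ⟨M, hM⟩ := hF
  have e : Option F ≃ Fin (Fintype.card F + 1) := Fintype.equivFinOfCardEq (by simp)
  obtain ⟨N, hN, hrow, hcol⟩ := (hM.comp e e.injective e).exists_normalized none
  have hsum : ∀ i : F, ∑ j, N (some i) (some j) = -1 := fun i => by
    have := hN.orthogonal (some i) none (by simp)
    simp only [Fintype.sum_option, hrow, hcol, mul_one] at this
    linarith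
  have hdot : ∀ i i' : F, ∑ j, N (some i) (some j) * N (some i') (some j) =
      if i = i' then (Fintype.card F : ℤ) else -1 := fun i i' => by
    split_ifs with h
    · subst h
      simp [hN.mul_self]
    · have := hN.orthogonal (some i) (some i') (by simpa using h)
      simp only [Fintype.sum_option, hcol, mul_one] at this
      linarith
  -- The row `(a, b)` is the line `i ↦ a * i + b`: block `i` holds the core row indexed by its value
  -- there, and block `none` the core row of its slope. Two distinct lines agree in exactly one of
  -- the `q + 1` blocks, so their inner product is `q + q * (-1) = 0`. The `q` remaining rows are
  -- constant on blocks.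
  refine OrthogonalSigns.isHadamardOrder (ι := (F × F) ⊕ F) (κ := Option F × F)
    (M := Sum.elim (fun ab j => N (some (j.1.elim ab.1 fun i => ab.1 * i + ab.2)) (some j.2))
      fun k j => N (some k) j.1) ⟨?_, ?_⟩ (by simp; ring) (by simp; ring)
  · rintro (i | i) j <;> exact hN.entry _ _
  · have hcross : ∀ (a b k : F), ∑ j : Option F × F,
        N (some (j.1.elim a fun i => a * i + b)) (some j.2) * N (some k) j.1 = 0 := by
      intro a b k
      rw [Fintype.sum_prod_type]
      simp_rw [← Finset.sum_mul, hsum, ← Finset.mul_sum]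
      have := hN.orthogonal (some k) none (by simp)
      simp only [hrow, mul_one] at this
      rw [this, mul_zero]
    rintro (⟨a, b⟩ | k) (⟨a', b'⟩ | k') hi
    · simp only [Sum.elim_inl]
      rw [Fintype.sum_prod_type, Fintype.sum_option]
      simp_rw [Option.elim, hdot]
      by_cases ha : a = a'
      · subst ha
        have hb : b ≠ b' := fun h => hi (by rw [h])
        simp [hb]
      · have hiff : ∀ i : F, a * i + b = a' * i + b' ↔ i = (b' - b) / (a - a') := fun i => by
          rw [eq_div_iff (sub_ne_zero.mpr ha)]
          constructor <;> intro h <;> linear_combination h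
        simp_rw [hiff, if_neg ha]
        rw [← Finset.add_sum_erase _ _ (Finset.mem_univ ((b' - b) / (a - a'))), if_pos rfl,
          Finset.sum_congr rfl fun i hi => if_neg (Finset.ne_of_mem_erase hi)]
        simp [Finset.card_erase_of_mem, Nat.cast_sub Fintype.card_pos]
    · exact hcross a b k'
    · simp only [Sum.elim_inl, Sum.elim_inr]
      simp_rw [mul_comm (N (some k) _)]
      exact hcross a' b' k
    · simp only [Sum.elim_inr]
      rw [Fintype.sum_prod_type]
      have := hN.orthogonal (some k) (some k') (by simpa using hi)
      simp [← Finset.mul_sum, this]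

/-- The properties of the quadratic character used in Paley's constructions. -/
theorem exists_quadratic_sign (hF : Fintype.card F % 2 = 1) :
    ∃ χ : F → ℤ, χ 0 = 0 ∧ (∀ x, x ≠ 0 → χ x = 1 ∨ χ x = -1) ∧ (∀ x, ∑ y, χ (y - x) = 0) ∧
      (∀ x x', x ≠ x' → ∑ y, χ (y - x) * χ (y - x') = -1) ∧
      (∀ x x', χ (x - x') = (if Fintype.card F % 4 = 3 then -1 else 1) * χ (x' - x)) := by
  classical
  have hc : ringChar F ≠ 2 := fun h2 => by
    have := FiniteField.even_card_of_char_two h2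
    omega
  refine ⟨quadraticChar F, quadraticChar_zero, fun x hx => quadraticChar_dichotomy hx,
    fun x => ?_, fun x x' h => ?_, fun x x' => ?_⟩
  · exact (Equiv.sum_comp (Equiv.subRight x) fun y => quadraticChar F y).trans
      (quadraticChar_sum_zero hc)
  · have hc' : x' - x ≠ 0 := sub_ne_zero.mpr h.symm
    -- The substitution `y = x + (x' - x) * t` turns the correlation into `χ(-1)` times the Jacobi
    -- sum of `χ` and `χ⁻¹`, which equals `-χ(-1)`.
    let e : F ≃ F := (Equiv.mulLeft₀ (x' - x) hc').trans (Equiv.addLeft x)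
    have he : ∀ t, quadraticChar F (e t - x) * quadraticChar F (e t - x') =
        quadraticChar F (-1) * (quadraticChar F t * (quadraticChar F)⁻¹ (1 - t)) := fun t => by
      have h1 : e t - x = (x' - x) * t := by simp [e]
      have h2 : e t - x' = (x' - x) * (-1 * (1 - t)) := by simp [e]; ring
      rw [h1, h2, (quadraticChar_isQuadratic F).inv]
      simp only [map_mul]
      linear_combination (quadraticChar F t * quadraticChar F (-1) * quadraticChar F (1 - t)) *
        quadraticChar_sq_one hc'
    rw [← Equiv.sum_comp e]
    simp_rw [he]
    rw [← Finset.mul_sum]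
    change quadraticChar F (-1) * jacobiSum (quadraticChar F) (quadraticChar F)⁻¹ = -1
    rw [jacobiSum_nontrivial_inv (quadraticChar_ne_one hc)]
    linear_combination -quadraticChar_sq_one (F := F) (neg_ne_zero.mpr one_ne_zero)
  · rw [← neg_sub, ← neg_one_mul, map_mul]
    split_ifs with h
    · congr 1
      rw [quadraticChar_neg_one_iff_not_isSquare, FiniteField.isSquare_neg_one_iff]
      simpa using h
    · congr 1
      rw [quadraticChar_one_iff_isSquare (neg_ne_zero.mpr one_ne_zero),
        FiniteField.isSquare_neg_one_iff]
      exact h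

/-- Paley's first construction. -/
theorem paley_one (hF : Fintype.card F % 4 = 3) : IsHadamardOrder (Fintype.card F + 1) := by
  classical
  obtain ⟨χ, h0, hpm, hs, hd, hskew⟩ := exists_quadratic_sign (F := F) (by omega)
  simp only [hF, if_true, neg_one_mul] at hskew
  -- As `χ` is odd here, filling the zero diagonal with `1` adds `χ(x' - x) + χ(x - x') = 0` to the
  -- correlations. They stay `-1`, and the border column compensates for this.
  let N : F → F → ℤ := fun x y => (if x = y then 1 else 0) + χ (y - x)
  have hsum : ∀ x, ∑ y, N x y = 1 := fun x => by
    simp [N, Finset.sum_add_distrib, hs]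
  have hdot : ∀ x x', x ≠ x' → ∑ y, N x y * N x' y = -1 := fun x x' h => by
    simp only [N, add_mul, mul_add, Finset.sum_add_distrib]
    simp [h, hd x x' h, hskew x x']
  refine OrthogonalSigns.isHadamardOrder (ι := Option F) (κ := Option F)
    (M := fun i j => i.elim 1 fun x => j.elim (-1) fun y => N x y) ⟨?_, ?_⟩ (by simp) (by simp)
  · rintro (_ | x) (_ | y)
    · simp
    · simp
    · simp
    · by_cases h : x = y
      · simp [N, h, h0]
      · simpa [N, h] using hpm _ (sub_ne_zero.mpr (Ne.symm h))
  · rintro (_ | x) (_ | x') h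
    · exact absurd rfl h
    · simp [Fintype.sum_option, hsum]
    · simp [Fintype.sum_option, hsum]
    · simp [Fintype.sum_option, hdot x x' (by simpa using h)]

/-- Paley's second construction. -/
theorem paley_two (hF : Fintype.card F % 4 = 1) : IsHadamardOrder (2 * (Fintype.card F + 1)) := by
  classical
  obtain ⟨χ, h0, hpm, hs, hd, hsymm⟩ := exists_quadratic_sign (F := F) (by omega)
  rw [if_neg (by omega)] at hsymm
  simp only [one_mul] at hsymm
  -- A symmetric conference matrix: zero diagonal, signs elsewhere, orthogonal rows.
  let C : Option F → Option F → ℤ := fun i j =>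
    i.elim (j.elim 0 fun _ => 1) fun x => j.elim 1 fun y => χ (y - x)
  have hC : ∀ i i', C i i' = C i' i := by
    rintro (_ | x) (_ | x')
    · rfl
    · rfl
    · rfl
    · exact hsymm _ _
  have hdiag : ∀ i, C i i = 0 := by
    rintro (_ | x)
    · rfl
    · simp [C, h0]
  have hoff : ∀ i j, i ≠ j → C i j = 1 ∨ C i j = -1 := by
    rintro (_ | x) (_ | y) h
    · exact absurd rfl h
    · simp [C]
    · simp [C]
    · exact hpm _ (sub_ne_zero.mpr fun e => h (by rw [e]))
  have hdot : ∀ i i', i ≠ i' → ∑ j, C i j * C i' j = 0 := by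
    rintro (_ | x) (_ | x') h
    · exact absurd rfl h
    · simp [C, Fintype.sum_option, hs]
    · simp [C, Fintype.sum_option, hs]
    · simp [C, Fintype.sum_option, 
        hd x x' (show x ≠ x' from fun e => h (by rw [e]))]
  let I : Option F → Option F → ℤ := fun i j => if i = j then 1 else 0
  -- This is `C ⊗ A + I ⊗ B` with `A = (1, 1; 1, -1)` and `B = (1, -1; -1, -1)`. Since `A` and `B`
  -- anticommute and `C` is symmetric, the cross terms cancel.
  refine OrthogonalSigns.isHadamardOrder (ι := Option F ⊕ Option F) (κ := Option F ⊕ Option F)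
    (M := Sum.elim (fun i => Sum.elim (fun j => C i j + I i j) fun j => C i j - I i j)
      fun i => Sum.elim (fun j => C i j - I i j) fun j => - C i j - I i j)
    ⟨?_, ?_⟩ (by simp; ring) (by simp; ring)
  · rintro (i | i) (j | j) <;> by_cases h : i = j
    all_goals first
      | (subst h; simp [I, hdiag])
      | (rcases hoff i j h with h' | h' <;> simp [I, h, h'])
  · have hCI : ∀ i i', ∑ j, C i j * I i' j = C i i' := fun i i' => by simp [I]
    have hIC : ∀ i i', ∑ j, I i j * C i' j = C i' i := fun i i' => by simp [I]
    have hII : ∀ i i', i ≠ i' → ∑ j, I i j * I i' j = 0 := fun i i' h => by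
      simp [I, h]
    rintro (i | i) (i' | i') h <;>
      simp only [Fintype.sum_sum_type, Sum.elim_inl, Sum.elim_inr, add_mul, mul_add, sub_mul,
        mul_sub, neg_mul, mul_neg, Finset.sum_add_distrib, Finset.sum_sub_distrib,
        Finset.sum_neg_distrib, hCI, hIC]
    · have h' : i ≠ i' := fun e => h (by rw [e])
      rw [hdot i i' h', hII i i' h']
      ring
    · rw [hC i i']
      ring
    · rw [hC i i']
      ring
    · have h' : i ≠ i' := fun e => h (by rw [e])
      rw [hdot i i' h', hII i i' h']
      ring

end FiniteField

/-- The Goethals–Seidel array. -/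
theorem goethals_seidel {A : Type*} [AddCommGroup A] [Fintype A] (a b c d : A → ℤ)
    (ha : ∀ x, a x = 1 ∨ a x = -1) (hb : ∀ x, b x = 1 ∨ b x = -1)
    (hc : ∀ x, c x = 1 ∨ c x = -1) (hd : ∀ x, d x = 1 ∨ d x = -1)
    (h : ∀ t, t ≠ 0 → ∑ y, a y * a (y + t) + ∑ y, b y * b (y + t) +
      ∑ y, c y * c (y + t) + ∑ y, d y * d (y + t) = 0) :
    IsHadamardOrder (4 * Fintype.card A) := by
  let N : Fin 4 → A → Fin 4 → A → ℤ := fun i x j y =>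
    !![a (y - x), b (-x - y), c (-x - y), d (-x - y);
      -b (-x - y), a (y - x), d (x + y), -c (x + y);
      -c (-x - y), -d (x + y), a (y - x), b (x + y);
      -d (-x - y), c (x + y), -b (x + y), a (y - x)] i j
  -- For two rows in the same block row, each block contributes an autocorrelation at `x - x'`,
  -- whether it depends on `y - x` or on `±(x + y)`. For different block rows, `h4` to `h6` match
  -- the cross-correlations in pairs by translating or reflecting `y`, and the signs of the array
  -- cancel each pair.
  have h1 : ∀ (f : A → ℤ) (x x' : A),
      ∑ y, f (y - x) * f (y - x') = ∑ y, f y * f (y + (x - x')) := fun f x x' => by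
    rw [← Equiv.sum_comp (Equiv.addRight x)]
    refine Finset.sum_congr rfl fun y _ => ?_
    simp only [Equiv.coe_addRight]
    congr 2 <;> abel
  have h2 : ∀ (f : A → ℤ) (x x' : A),
      ∑ y, f (x + y) * f (x' + y) = ∑ y, f y * f (y + (x - x')) := fun f x x' => by
    rw [← Equiv.sum_comp (Equiv.subRight x')]
    refine Finset.sum_congr rfl fun y _ => ?_
    simp only [Equiv.subRight_apply]
    rw [mul_comm]
    congr 2 <;> abel
  have h3 : ∀ (f : A → ℤ) (x x' : A),
      ∑ y, f (-x - y) * f (-x' - y) = ∑ y, f y * f (y + (x - x')) := fun f x x' => by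
    rw [← Equiv.sum_comp ((Equiv.neg A).trans (Equiv.subRight x))]
    refine Finset.sum_congr rfl fun y _ => ?_
    simp only [Equiv.trans_apply, Equiv.neg_apply, Equiv.subRight_apply]
    congr 2 <;> abel
  have h4 : ∀ (f g : A → ℤ) (x x' : A),
      ∑ y, f (-x - y) * g (-x' - y) = ∑ y, g (x + y) * f (x' + y) := fun f g x x' => by
    rw [← Equiv.sum_comp ((Equiv.neg A).trans (Equiv.subRight (x + x')))]
    refine Finset.sum_congr rfl fun y _ => ?_
    simp only [Equiv.trans_apply, Equiv.neg_apply, Equiv.subRight_apply]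
    rw [mul_comm]
    congr 2 <;> abel
  have h4' : ∀ (f g : A → ℤ) (x x' : A),
      ∑ y, f (-x - y) * g (x' + y) = ∑ y, g (-x - y) * f (x' + y) := fun f g x x' => by
    rw [← Equiv.sum_comp ((Equiv.neg A).trans (Equiv.subRight (x + x')))]
    refine Finset.sum_congr rfl fun y _ => ?_
    simp only [Equiv.trans_apply, Equiv.neg_apply, Equiv.subRight_apply]
    rw [mul_comm]
    congr 2 <;> abel
  have h5 : ∀ (f g : A → ℤ) (x x' : A),
      ∑ y, f (y - x) * g (-x' - y) = ∑ y, g (-x - y) * f (y - x') := fun f g x x' => by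
    rw [← Equiv.sum_comp (Equiv.addRight (x - x'))]
    refine Finset.sum_congr rfl fun y _ => ?_
    simp only [Equiv.coe_addRight]
    rw [mul_comm]
    congr 2 <;> abel
  have h6 : ∀ (f g : A → ℤ) (x x' : A),
      ∑ y, f (y - x) * g (x' + y) = ∑ y, g (x + y) * f (y - x') := fun f g x x' => by
    rw [← Equiv.sum_comp (Equiv.addRight (x - x'))]
    refine Finset.sum_congr rfl fun y _ => ?_
    simp only [Equiv.coe_addRight]
    rw [mul_comm]
    congr 2 <;> abel
  have key : ∀ i i' x x', i < i' ∨ (i = i' ∧ x ≠ x') →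
      ∑ j, ∑ y, N i x j y * N i' x' j y = 0 := by
    intro i i' x x' hi
    rw [Fin.sum_univ_four]
    fin_cases i <;> fin_cases i' <;> simp at hi <;> simp [N, Finset.sum_neg_distrib]
    · simp only [h1, h3]
      linear_combination h _ (sub_ne_zero.mpr hi)
    · linear_combination h4' c d x x' - h5 a b x x'
    · linear_combination -h5 a c x x' - h4' b d x x'
    · linear_combination h4' b c x x' - h5 a d x x'
    · simp only [h1, h2, h3]
      linear_combination h _ (sub_ne_zero.mpr hi)
    · linear_combination h4 b c x x' - h6 a d x x'
    · linear_combination h4 b d x x' + h6 a c x x'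
    · simp only [h1, h2, h3]
      linear_combination h _ (sub_ne_zero.mpr hi)
    · linear_combination h4 c d x x' - h6 a b x x'
    · simp only [h1, h2, h3]
      linear_combination h _ (sub_ne_zero.mpr hi)
  refine OrthogonalSigns.isHadamardOrder (ι := Fin 4 × A) (κ := Fin 4 × A)
    (M := fun i j => N i.1 i.2 j.1 j.2) ⟨?_, ?_⟩ (by simp) (by simp)
  · rintro ⟨i, x⟩ ⟨j, y⟩
    fin_cases i <;> fin_cases j <;> simp [N, ha, hb, hc, hd, neg_eq_iff_eq_neg, or_comm]
  · rintro ⟨i, x⟩ ⟨i', x'⟩ hi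
    rw [Fintype.sum_prod_type]
    rcases lt_trichotomy i i' with hlt | rfl | hlt
    · exact key i i' x x' (Or.inl hlt)
    · exact key i i x x' (Or.inr ⟨rfl, fun e => hi (by rw [e])⟩)
    · simp_rw [mul_comm (N i x _ _)]
      exact key i' i x' x (Or.inl hlt)

end IsHadamardOrder

/-! ### Golay pairs and Hadamard matrices of order `4 (2^h + 1)`. -/

/-- Golay complementary pairs of sequences of length `2 ^ k`. -/
def golayPair : ℕ → (ℕ → ℤ) × (ℕ → ℤ)
  | 0 => (fun _ => 1, fun _ => 1)
  | k + 1 =>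
    (fun i => if i < 2 ^ k then (golayPair k).1 i else (golayPair k).2 (i - 2 ^ k),
      fun i => if i < 2 ^ k then (golayPair k).1 i else -(golayPair k).2 (i - 2 ^ k))

theorem golayPair_entry (k i : ℕ) :
    ((golayPair k).1 i = 1 ∨ (golayPair k).1 i = -1) ∧
      ((golayPair k).2 i = 1 ∨ (golayPair k).2 i = -1) := by
  induction k generalizing i with
  | zero => simp [golayPair]
  | succ k ih =>
    simp only [golayPair]
    split_ifs
    · exact ⟨(ih i).1, (ih i).1⟩
    · refine ⟨(ih _).2, ?_⟩
      rcases (ih (i - 2 ^ k)).2 with h | h <;> simp [h]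

theorem golayPair_sum_succ {R : Type*} [CommRing R] (k : ℕ) (z : R) :
    (∑ i ∈ Finset.range (2 ^ (k + 1)), ((golayPair (k + 1)).1 i : R) * z ^ i =
      ∑ i ∈ Finset.range (2 ^ k), ((golayPair k).1 i : R) * z ^ i +
        z ^ 2 ^ k * ∑ i ∈ Finset.range (2 ^ k), ((golayPair k).2 i : R) * z ^ i) ∧
    (∑ i ∈ Finset.range (2 ^ (k + 1)), ((golayPair (k + 1)).2 i : R) * z ^ i =
      ∑ i ∈ Finset.range (2 ^ k), ((golayPair k).1 i : R) * z ^ i -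
        z ^ 2 ^ k * ∑ i ∈ Finset.range (2 ^ k), ((golayPair k).2 i : R) * z ^ i) := by
  rw [pow_succ 2 k, mul_two, Finset.sum_range_add, Finset.sum_range_add, Finset.mul_sum,
    sub_eq_add_neg, ← Finset.sum_neg_distrib]
  constructor <;> congr 1 <;> refine Finset.sum_congr rfl fun i hi => ?_
  · simp [golayPair, Finset.mem_range.mp hi]
  · simp [golayPair, pow_add]
    ring
  · simp [golayPair, Finset.mem_range.mp hi]
  · simp [golayPair, pow_add]
    ring

/-- Here `w` plays the role of `z⁻¹`, and the induction step is the parallelogram identity. A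
general commutative ring is allowed so that `z` can be a group element in a group ring. -/
theorem golayPair_complementary {R : Type*} [CommRing R] (k : ℕ) {z w : R} (h : z * w = 1) :
    (∑ i ∈ Finset.range (2 ^ k), ((golayPair k).1 i : R) * z ^ i) *
        (∑ i ∈ Finset.range (2 ^ k), ((golayPair k).1 i : R) * w ^ i) +
      (∑ i ∈ Finset.range (2 ^ k), ((golayPair k).2 i : R) * z ^ i) *
        (∑ i ∈ Finset.range (2 ^ k), ((golayPair k).2 i : R) * w ^ i) = 2 ^ (k + 1) := by
  induction k with
  | zero => simp [golayPair]; norm_num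
  | succ k ih =>
    have hzw : z ^ 2 ^ k * w ^ 2 ^ k = 1 := by rw [← mul_pow, h, one_pow]
    rw [(golayPair_sum_succ k z).1, (golayPair_sum_succ k z).2, (golayPair_sum_succ k w).1,
      (golayPair_sum_succ k w).2, pow_succ, ← ih]
    linear_combination 2 * (∑ i ∈ Finset.range (2 ^ k), ((golayPair k).2 i : R) * z ^ i) *
        (∑ i ∈ Finset.range (2 ^ k), ((golayPair k).2 i : R) * w ^ i) * hzw

/-- The periodic autocorrelations of a function are the coefficients in the group ring. -/
theorem AddMonoidAlgebra.coeff_sum_single_mul {A : Type*} [AddCommGroup A] [Fintype A]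
    (f : A → ℤ) (t : A) :
    ((∑ x, AddMonoidAlgebra.single x (f x)) * ∑ x, AddMonoidAlgebra.single (-x) (f x)).coeff t =
      ∑ y, f y * f (y + t) := by
  classical
  rw [Finset.sum_mul_sum, Finset.sum_comm]
  simp only [AddMonoidAlgebra.single_mul_single, AddMonoidAlgebra.coeff_sum,
    AddMonoidAlgebra.coeff_single, Finsupp.finsetSum_apply, Finsupp.single_apply]
  refine Finset.sum_congr rfl fun y _ => ?_
  have : ∀ x : A, x + -y = t ↔ y + t = x := fun x => by
    rw [← sub_eq_add_neg, sub_eq_iff_eq_add, add_comm t, eq_comm]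
  simp [this, mul_comm]

theorem AddMonoidAlgebra.single_nsmul_eq {A : Type*} [AddCommMonoid A] (u : A) (c : ℤ) (i : ℕ) :
    (AddMonoidAlgebra.single (i • u) c : AddMonoidAlgebra ℤ A) =
      (c : AddMonoidAlgebra ℤ A) * AddMonoidAlgebra.single u 1 ^ i := by
  simp [AddMonoidAlgebra.single_pow, AddMonoidAlgebra.intCast_def,
    AddMonoidAlgebra.single_mul_single]

/-- The sequence `1, ε F, δ G` of length `2 ^ (k + 1) + 1`, for a Golay pair `(F, G)`. -/
def golaySequence (k : ℕ) (ε δ : ℤ) (i : ℕ) : ℤ :=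
  if i = 0 then 1 else if i ≤ 2 ^ k then ε * (golayPair k).1 (i - 1)
    else δ * (golayPair k).2 (i - 1 - 2 ^ k)

theorem golaySequence_entry (k : ℕ) {ε δ : ℤ} (hε : ε = 1 ∨ ε = -1) (hδ : δ = 1 ∨ δ = -1)
    (i : ℕ) : golaySequence k ε δ i = 1 ∨ golaySequence k ε δ i = -1 := by
  unfold golaySequence
  split_ifs
  · simp
  · rcases hε with rfl | rfl <;> rcases (golayPair_entry k (i - 1)).1 with h | h <;> simp [h]
  · rcases hδ with rfl | rfl <;> rcases (golayPair_entry k (i - 1 - 2 ^ k)).2 with h | h <;>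
      simp [h]

theorem golaySequence_sum {R : Type*} [CommRing R] (k : ℕ) (ε δ : ℤ) (z : R) :
    ∑ i ∈ Finset.range (2 * 2 ^ k + 1), (golaySequence k ε δ i : R) * z ^ i =
      1 + ε * z * (∑ i ∈ Finset.range (2 ^ k), ((golayPair k).1 i : R) * z ^ i) +
        δ * z ^ (2 ^ k + 1) * ∑ i ∈ Finset.range (2 ^ k), ((golayPair k).2 i : R) * z ^ i := by
  rw [Finset.sum_range_succ', two_mul, Finset.sum_range_add, Finset.mul_sum,
    Finset.mul_sum, add_comm, add_assoc]
  congr 1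
  · simp [golaySequence]
  congr 1 <;> refine Finset.sum_congr rfl fun i hi => ?_
  · have : i + 1 ≤ 2 ^ k := Finset.mem_range.mp hi
    simp [golaySequence, this, pow_succ]
    ring
  · have : ¬ 2 ^ k + i + 1 ≤ 2 ^ k := by omega
    have h2 : 2 ^ k + i + 1 - 1 - 2 ^ k = i := by omega
    simp only [golaySequence, this, h2, if_false, Nat.succ_ne_zero]
    push_cast
    ring

/-- The cross terms carry a factor `ε`, `δ` or `ε δ` and vanish on summing over the four sign
choices. What remains is `4 (1 + F F' + G G')`, a constant by the Golay property. -/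
theorem golaySequence_complementary {R : Type*} [CommRing R] (k : ℕ) {z w : R}
    (hzw : z * w = 1) (S : ℤ → ℤ → R → R)
    (hS : ∀ ε δ z, S ε δ z =
      ∑ i ∈ Finset.range (2 * 2 ^ k + 1), (golaySequence k ε δ i : R) * z ^ i) :
    S 1 1 z * S 1 1 w + S 1 (-1) z * S 1 (-1) w + S (-1) 1 z * S (-1) 1 w +
      S (-1) (-1) z * S (-1) (-1) w = ((4 + 4 * 2 ^ (k + 1) : ℤ) : R) := by
  have hgol := golayPair_complementary k hzw
  have hzw' : z ^ (2 ^ k + 1) * w ^ (2 ^ k + 1) = 1 := by rw [← mul_pow, hzw, one_pow]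
  simp only [hS, golaySequence_sum]
  push_cast
  set F := ∑ i ∈ Finset.range (2 ^ k), ((golayPair k).1 i : R) * z ^ i
  set F' := ∑ i ∈ Finset.range (2 ^ k), ((golayPair k).1 i : R) * w ^ i
  set G := ∑ i ∈ Finset.range (2 ^ k), ((golayPair k).2 i : R) * z ^ i
  set G' := ∑ i ∈ Finset.range (2 ^ k), ((golayPair k).2 i : R) * w ^ i
  linear_combination 4 * hgol + 4 * F * F' * hzw + 4 * G * G' * hzw'

theorem Fin.val_nsmul_one (m n : ℕ) : ((n • (1 : Fin (m + 1)) : Fin (m + 1)) : ℕ) = n % (m + 1) := by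
  induction n with
  | zero => simp
  | succ n ih => rw [succ_nsmul, Fin.val_add, ih, Fin.val_one', ← Nat.add_mod]

/-- In the group ring of the cyclic group of order `2 * 2 ^ k + 1`, let `z` and `w` be the group
elements `1` and `-1`. The autocorrelation sum at `t` is the coefficient at `t` of an integer
constant, hence `0` for `t ≠ 0`. -/
theorem golaySequence_autocorrelation (k : ℕ) (t : Fin (2 * 2 ^ k + 1)) (ht : t ≠ 0)
    (f : ℤ → ℤ → Fin (2 * 2 ^ k + 1) → ℤ) (hf : ∀ ε δ x, f ε δ x = golaySequence k ε δ x) :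
    ∑ y, f 1 1 y * f 1 1 (y + t) + ∑ y, f 1 (-1) y * f 1 (-1) (y + t) +
      ∑ y, f (-1) 1 y * f (-1) 1 (y + t) + ∑ y, f (-1) (-1) y * f (-1) (-1) (y + t) = 0 := by
  let S : ℤ → ℤ → AddMonoidAlgebra ℤ (Fin (2 * 2 ^ k + 1)) →
      AddMonoidAlgebra ℤ (Fin (2 * 2 ^ k + 1)) := fun ε δ z =>
    ∑ i ∈ Finset.range (2 * 2 ^ k + 1),
      (golaySequence k ε δ i : AddMonoidAlgebra ℤ (Fin (2 * 2 ^ k + 1))) * z ^ i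
  have hsum : ∀ (ε δ : ℤ) (u : Fin (2 * 2 ^ k + 1)),
      ∑ x : Fin (2 * 2 ^ k + 1), AddMonoidAlgebra.single ((x : ℕ) • u) (f ε δ x) =
        S ε δ (AddMonoidAlgebra.single u 1) := by
    intro ε δ u
    simp only [S]
    rw [← Fin.sum_univ_eq_sum_range fun i =>
      (golaySequence k ε δ i : AddMonoidAlgebra ℤ (Fin (2 * 2 ^ k + 1))) *
        AddMonoidAlgebra.single u 1 ^ i]
    refine Finset.sum_congr rfl fun x _ => ?_
    rw [hf, AddMonoidAlgebra.single_nsmul_eq]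
  have h1 : ∀ x : Fin (2 * 2 ^ k + 1), (x : ℕ) • (1 : Fin (2 * 2 ^ k + 1)) = x := fun x => by
    rw [Fin.ext_iff, Fin.val_nsmul_one, Nat.mod_eq_of_lt x.isLt]
  have h2 : ∀ x : Fin (2 * 2 ^ k + 1), (x : ℕ) • (-1 : Fin (2 * 2 ^ k + 1)) = -x := fun x => by
    rw [smul_neg, h1]
  have hz := fun ε δ => hsum ε δ 1
  have hw := fun ε δ => hsum ε δ (-1)
  simp only [h1] at hz
  simp only [h2] at hw
  have hzw : (AddMonoidAlgebra.single 1 1 * AddMonoidAlgebra.single (-1) 1 :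
      AddMonoidAlgebra ℤ (Fin (2 * 2 ^ k + 1))) = 1 := by
    rw [AddMonoidAlgebra.single_mul_single, add_neg_cancel, one_mul, AddMonoidAlgebra.one_def]
  simp only [← AddMonoidAlgebra.coeff_sum_single_mul, hz, hw]
  rw [← Finsupp.add_apply, ← Finsupp.add_apply, ← Finsupp.add_apply,
    ← AddMonoidAlgebra.coeff_add, ← AddMonoidAlgebra.coeff_add, ← AddMonoidAlgebra.coeff_add,
    golaySequence_complementary k hzw S fun _ _ _ => rfl, AddMonoidAlgebra.intCast_def,
    AddMonoidAlgebra.coeff_single, Finsupp.single_eq_of_ne ht]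

/-- Covers the second form for `q = 2`, where `q ^ h` is even and Paley's constructions do not
apply. -/
theorem IsHadamardOrder.four_mul_two_pow_add_one {h : ℕ} (hh : 1 ≤ h) :
    IsHadamardOrder (4 * (2 ^ h + 1)) := by
  obtain ⟨k, rfl⟩ : ∃ k, h = k + 1 := ⟨h - 1, by omega⟩
  have hG := IsHadamardOrder.goethals_seidel (A := Fin (2 * 2 ^ k + 1))
    (fun x => golaySequence k 1 1 x) (fun x => golaySequence k 1 (-1) x)
    (fun x => golaySequence k (-1) 1 x) (fun x => golaySequence k (-1) (-1) x)
    (fun x => golaySequence_entry _ (by simp) (by simp) x)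
    (fun x => golaySequence_entry _ (by simp) (by simp) x)
    (fun x => golaySequence_entry _ (by simp) (by simp) x)
    (fun x => golaySequence_entry _ (by simp) (by simp) x)
    fun t ht => golaySequence_autocorrelation k t ht (fun ε δ x => golaySequence k ε δ x)
      fun _ _ _ => rfl
  rwa [Fintype.card_fin, mul_comm 2, ← pow_succ] at hG

/-! ### The five forms are Hadamard orders. -/

/-- For every prime power there is a finite field of that order. -/
theorem IsPrimePow.exists_field {q : ℕ} (hq : IsPrimePow q) :
    ∃ (F : Type) (_ : Field F) (_ : Fintype F), Fintype.card F = q := by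
  obtain ⟨p, k, hp, hk, rfl⟩ := (isPrimePow_nat_iff q).mp hq
  have := Fact.mk hp
  have := Fintype.ofFinite (GaloisField p k)
  exact ⟨GaloisField p k, inferInstance, inferInstance, by
    rw [← Nat.card_eq_fintype_card, GaloisField.card p k hk.ne']⟩

theorem IsHadamardOrder.of_mem_hadamardOrders {n : ℕ} (hn : n ∈ hadamardOrders) :
    IsHadamardOrder n := by
  have paley_one : ∀ {q : ℕ}, IsPrimePow q → q % 4 = 3 → IsHadamardOrder (q + 1) := by
    intro q hq h
    obtain ⟨F, _, _, rfl⟩ := hq.exists_field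
    exact IsHadamardOrder.paley_one h
  have paley_two : ∀ {q : ℕ}, IsPrimePow q → q % 4 = 1 → IsHadamardOrder (2 * (q + 1)) := by
    intro q hq h
    obtain ⟨F, _, _, rfl⟩ := hq.exists_field
    exact IsHadamardOrder.paley_two h
  rcases hn with ⟨p, -, rfl⟩ | ⟨p, h, q, hp, hh, hq, rfl⟩ | ⟨p, q, -, hq, hq3, rfl⟩ |
    ⟨q, hq, hq3, rfl⟩ | ⟨q, hq, hq1, rfl⟩
  · simpa using IsHadamardOrder.one.two_pow_mul p
  · obtain ⟨p, rfl⟩ := Nat.exists_eq_add_of_le' hp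
    rcases hq.eq_two_or_odd with rfl | hodd
    · rw [pow_add, mul_assoc]
      exact (IsHadamardOrder.four_mul_two_pow_add_one hh).two_pow_mul p
    · have hpow : IsPrimePow (q ^ h) := hq.isPrimePow.pow (by omega)
      have hodd' : (q ^ h) % 2 = 1 := Nat.odd_iff.mp ((Nat.odd_iff.mpr hodd).pow)
      obtain h1 | h3 : q ^ h % 4 = 1 ∨ q ^ h % 4 = 3 := by omega
      -- Paley's second construction already supplies one factor `2`.
      · have := (paley_two hpow h1).two_pow_mul (p + 1)
        rwa [← mul_assoc, ← pow_succ] at this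
      · exact (paley_one hpow h3).two_pow_mul _
  · obtain ⟨F, _, _, rfl⟩ := hq.isPrimePow.exists_field
    rw [mul_assoc]
    exact (IsHadamardOrder.paley_one hq3).scarpis.two_pow_mul p
  · exact paley_one hq hq3
  · exact paley_two hq hq1

/-! ### Signed graphs: adjacency matrices and eigenvectors. -/

namespace SignedGraph

section Basic

variable {V : Type u} (G : SignedGraph V)

theorem adjMatrix_of_adj {x y : V} (h : G.graph.Adj x y) :
    G.adjMatrix x y = ((G.sign ⟨s(x, y), h⟩ : ℤ) : ℝ) := by
  simp [adjMatrix, h]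

theorem adjMatrix_of_not_adj {x y : V} (h : ¬ G.graph.Adj x y) : G.adjMatrix x y = 0 := by
  simp [adjMatrix, h]

theorem adjMatrix_eq_one_or {x y : V} (h : G.graph.Adj x y) :
    G.adjMatrix x y = 1 ∨ G.adjMatrix x y = -1 := by
  rw [G.adjMatrix_of_adj h]
  rcases Int.units_eq_one_or (G.sign ⟨s(x, y), h⟩) with h | h <;> simp [h]

theorem adjMatrix_comm (x y : V) : G.adjMatrix x y = G.adjMatrix y x := by
  by_cases h : G.graph.Adj x y
  · rw [G.adjMatrix_of_adj h, G.adjMatrix_of_adj h.symm]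
    congr 3
    exact Subtype.ext Sym2.eq_swap
  · rw [G.adjMatrix_of_not_adj h, G.adjMatrix_of_not_adj fun h' => h h'.symm]

theorem adjMatrix_mul_self_le (x y : V) : G.adjMatrix x y * G.adjMatrix x y ≤ 1 := by
  by_cases h : G.graph.Adj x y
  · rcases G.adjMatrix_eq_one_or h with h | h <;> simp [h]
  · simp [G.adjMatrix_of_not_adj h]

theorem mem_eigenspace_iff [Fintype V] {μ : ℝ} {x : V → ℝ} :
    x ∈ Module.End.eigenspace G.adjOp μ ↔ ∀ v, ∑ w, G.adjMatrix v w * x w = μ * x v := by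
  rw [Module.End.mem_eigenspace_iff, funext_iff]
  rfl

theorem not_hasEigenvalue_of_graph_eq_bot {_ : Fintype V} (hG : ∀ x y, ¬ G.graph.Adj x y) {μ : ℝ}
    (hμ : μ ≠ 0) : ¬ G.HasEigenvalue μ := by
  intro h
  obtain ⟨x, hx⟩ := h.exists_hasEigenvector
  refine hx.2 (funext fun v => ?_)
  have := G.mem_eigenspace_iff.mp hx.1 v
  simp only [G.adjMatrix_of_not_adj (hG _ _), zero_mul, Finset.sum_const_zero] at this
  simpa [hμ] using this.symm

theorem isomorphic_edgeless {s : ℕ} (hG : ∀ x y, ¬ G.graph.Adj x y) (hs : Nat.card V = s)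
    [Finite V] : G.Isomorphic (edgeless (Fin s)) := by
  refine ⟨⟨Finite.equivFinOfCardEq hs, fun {a b} => ?_⟩, ?_⟩
  · simp [edgeless, hG]
  · rintro ⟨e, he⟩
    induction e with
    | h x y => exact (hG x y he).elim

end Basic

theorem Bipartite.not_adj_of_common_neighbor {V : Type u} {G : SignedGraph V} (hG : G.Bipartite) {x y z : V}
    (hx : G.graph.Adj x z) (hy : G.graph.Adj y z) : ¬ G.graph.Adj x y := by
  obtain ⟨c⟩ := hG
  intro h
  have h1 := c.valid hx
  have h2 := c.valid hy
  have h3 := c.valid h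
  omega

/-! ### From an edgeless star complement to orthogonal sign vectors. -/

section StarComplement

variable {V : Type u} [Fintype V] {G : SignedGraph V} {μ : ℝ} {S : Set V}

/-- The reconstruction identity for a star complement without edges. -/
theorem IsStarSet.reconstruction [Fintype (Sᶜ : Set V)] (hS : G.IsStarSet μ S) (hμ : μ ≠ 0)
    (hE : ∀ x ∉ S, ∀ y ∉ S, ¬ G.graph.Adj x y) {u w : V} (hu : u ∈ S) (hw : w ∈ S) :
    μ * G.adjMatrix w u + ∑ v : (Sᶜ : Set V), G.adjMatrix w v * G.adjMatrix u v =
      open Classical in if w = u then μ ^ 2 else 0 := by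
  classical
  obtain ⟨-, hcard, -⟩ := hS
  have hA : ∀ x ∉ S, ∀ y ∉ S, G.adjMatrix x y = 0 := fun x hx y hy =>
    G.adjMatrix_of_not_adj (hE x hx y hy)
  have hsplit : ∀ f : V → ℝ, ∑ v, f v = ∑ v : S, f v + ∑ v : (Sᶜ : Set V), f v := fun f => by
    rw [← (Equiv.Set.sumCompl S).sum_comp, Fintype.sum_sum_type]
    simp
  -- Restriction of eigenvectors to `S`. If `x` vanishes on `S`, the eigenvalue equation off `S`
  -- reads `0 = μ * x v`, so `ρ` is injective; equality of dimensions makes it surjective.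
  let ρ : Module.End.eigenspace G.adjOp μ →ₗ[ℝ] (S → ℝ) :=
    (LinearMap.funLeft ℝ ℝ (Subtype.val : S → V)).comp (Submodule.subtype _)
  have hinj : Function.Injective ρ := by
    rw [← LinearMap.ker_eq_bot, LinearMap.ker_eq_bot']
    rintro ⟨x, hx⟩ hρ
    have hxS : ∀ v : S, x v = 0 := fun v => congrFun hρ v
    refine Subtype.ext (funext fun v => ?_)
    by_cases hv : v ∈ S
    · exact hxS ⟨v, hv⟩
    · have := G.mem_eigenspace_iff.mp hx v
      rw [hsplit, Finset.sum_eq_zero fun w _ => by rw [hxS, mul_zero],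
        Finset.sum_eq_zero fun w _ => by rw [hA v hv w w.2, zero_mul], add_zero] at this
      simpa [hμ] using this.symm
  have hsurj : Function.Surjective ρ := by
    refine (LinearMap.injective_iff_surjective_of_finrank_eq_finrank ?_).mp hinj
    rw [Module.finrank_fintype_fun_eq_card, ← Nat.card_eq_fintype_card, Nat.card_coe_set_eq]
    exact hcard.symm
  -- The eigenvector restricting to the indicator of `u` takes the value `μ⁻¹ * G.adjMatrix u v` at
  -- `v ∉ S`; its equation at `w` is the claim.
  obtain ⟨⟨x, hx⟩, hρ⟩ := hsurj (Pi.single ⟨u, hu⟩ 1)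
  have hxS : ∀ v : S, x v = Pi.single (M := fun _ => ℝ) (⟨u, hu⟩ : S) 1 v := fun v =>
    congrFun hρ v
  have hsum : ∀ y, G.adjMatrix y u + ∑ v : (Sᶜ : Set V), G.adjMatrix y v * x v = μ * x y := by
    intro y
    rw [← G.mem_eigenspace_iff.mp hx y, hsplit]
    congr 1
    simp [hxS, Pi.single_apply]
  have hxC : ∀ v : (Sᶜ : Set V), μ * x v = G.adjMatrix u v := fun v => by
    rw [← hsum v, Finset.sum_eq_zero fun w _ => by rw [hA v v.2 w w.2, zero_mul], add_zero,
      G.adjMatrix_comm]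
  simp_rw [← hxC, mul_left_comm _ μ, ← Finset.mul_sum]
  rw [← mul_add, hsum w, hxS ⟨w, hw⟩, Pi.single_apply]
  simp only [Subtype.mk.injEq]
  split_ifs <;> ring

theorem HasStarComplement.exists_orthogonalSigns {s : ℕ} (hs : 0 < s) (hμ : (s : ℝ) = μ ^ 2)
    (hG : G.Bipartite) (h : G.HasStarComplement (edgeless (Fin s)) μ) :
    ∃ (k : ℕ) (M : Fin k → Fin s → ℤ), OrthogonalSigns M ∧ Fintype.card V = s + k := by
  classical
  obtain ⟨S, hS, φ, -⟩ := h
  have hμ0 : μ ≠ 0 := by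
    rintro rfl
    simp at hμ
    omega
  have hE : ∀ x ∉ S, ∀ y ∉ S, ¬ G.graph.Adj x y := fun x hx y hy hxy => by
    have : (G.induce Sᶜ).graph.Adj ⟨x, hx⟩ ⟨y, hy⟩ := hxy
    exact (φ.map_rel_iff.mpr this : (⊥ : SimpleGraph (Fin s)).Adj _ _)
  have hrec := fun u w (hu : u ∈ S) (hw : w ∈ S) => hS.reconstruction hμ0 hE hu hw
  have hcard : Fintype.card (Sᶜ : Set V) = s := by
    rw [Fintype.card_congr φ.toEquiv, Fintype.card_fin]
  have hadj : ∀ u ∈ S, ∀ v ∉ S, G.graph.Adj u v := by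
    intro u hu v hv
    by_contra hn
    have h1 := hrec u u hu hu
    rw [if_pos rfl, G.adjMatrix_of_not_adj G.graph.irrefl, mul_zero, zero_add] at h1
    -- The diagonal identity makes `s` squares, each at most `1`, add up to `s`; so none of them is
    -- `0`.
    have h2 : ∑ v : (Sᶜ : Set V), (1 - G.adjMatrix u v * G.adjMatrix u v) = 0 := by
      rw [Finset.sum_sub_distrib, h1, ← hμ]
      simp [hcard]
    have h3 := (Finset.sum_eq_zero_iff_of_nonneg fun (v : (Sᶜ : Set V)) _ =>
      sub_nonneg.mpr (G.adjMatrix_mul_self_le u v)).mp h2 ⟨v, hv⟩ (Finset.mem_univ _)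
    simp [G.adjMatrix_of_not_adj hn] at h3
  let N : S → (Sᶜ : Set V) → ℤ := fun u v => G.sign ⟨s((u : V), (v : V)), hadj u u.2 v v.2⟩
  have hN : ∀ u v, (N u v : ℝ) = G.adjMatrix u v := fun u v =>
    (G.adjMatrix_of_adj (hadj u u.2 v v.2)).symm
  have hNorth : OrthogonalSigns N := by
    refine ⟨fun u v => ?_, fun u w huw => ?_⟩
    · rcases Int.units_eq_one_or (G.sign ⟨s((u : V), (v : V)), hadj u u.2 v v.2⟩) with h | h <;>
        simp [N, h]
    -- Since `s > 0`, any two vertices of `S` have a common neighbour outside `S`, so bipartiteness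
    -- makes them nonadjacent.
    · have hv := (φ.symm ⟨0, hs⟩ : (Sᶜ : Set V))
      have hn := hG.not_adj_of_common_neighbor (hadj u u.2 hv hv.2) (hadj w w.2 hv hv.2)
      have h1 := hrec w u w.2 u.2
      rw [if_neg (fun e => huw (Subtype.ext e)), G.adjMatrix_of_not_adj hn, mul_zero,
        zero_add] at h1
      simp_rw [← hN] at h1
      exact_mod_cast h1
  refine ⟨Fintype.card S, _, hNorth.comp (Fintype.equivFin S).symm
    (Fintype.equivFin S).symm.injective φ.toEquiv.symm, ?_⟩
  rw [← hcard, add_comm, ← Fintype.card_sum]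
  exact (Fintype.card_congr (Equiv.Set.sumCompl S)).symm

end StarComplement

/-! ### From orthogonal sign vectors to a signed complete bipartite graph. -/

section CompleteBipartite

variable {α β : Type u} (M : α → β → ℤ)

/-- The signs of the edges of the complete bipartite graph given by a sign matrix. -/
def bipartiteSign : α ⊕ β → α ⊕ β → ℤˣ
  | .inl a, .inr b => if M a b = 1 then 1 else -1
  | .inr b, .inl a => if M a b = 1 then 1 else -1
  | _, _ => 1

theorem bipartiteSign_comm (x y : α ⊕ β) : bipartiteSign M x y = bipartiteSign M y x := by
  rcases x with a | b <;> rcases y with a' | b' <;> rfl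

/-- The signed complete bipartite graph given by a sign matrix. -/
def ofSigns : SignedGraph (α ⊕ β) where
  graph := completeBipartiteGraph α β
  sign e := Sym2.lift ⟨bipartiteSign M, bipartiteSign_comm M⟩ e.1

variable {M} [Fintype β]

theorem adjMatrix_ofSigns_inl_inr (hM : OrthogonalSigns M) (a : α) (b : β) :
    (ofSigns M).adjMatrix (.inl a) (.inr b) = M a b := by
  rw [adjMatrix_of_adj _ (by simp [ofSigns])]
  rcases hM.entry a b with h | h <;> simp [ofSigns, bipartiteSign, h]

theorem adjMatrix_ofSigns_inr_inl (hM : OrthogonalSigns M) (a : α) (b : β) :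
    (ofSigns M).adjMatrix (.inr b) (.inl a) = M a b := by
  rw [adjMatrix_comm, adjMatrix_ofSigns_inl_inr hM]

theorem mem_eigenspace_ofSigns_iff [Fintype α] (hM : OrthogonalSigns M) {μ : ℝ}
    {x : α ⊕ β → ℝ} : x ∈ Module.End.eigenspace (ofSigns M).adjOp μ ↔
      (∀ a, ∑ b, (M a b : ℝ) * x (.inr b) = μ * x (.inl a)) ∧
        ∀ b, ∑ a, (M a b : ℝ) * x (.inl a) = μ * x (.inr b) := by
  have h1 : ∀ a a', (ofSigns M).adjMatrix (.inl a) (.inl a') = 0 := fun a a' =>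
    adjMatrix_of_not_adj _ (by simp [ofSigns])
  have h2 : ∀ b b', (ofSigns M).adjMatrix (.inr b) (.inr b') = 0 := fun b b' =>
    adjMatrix_of_not_adj _ (by simp [ofSigns])
  rw [mem_eigenspace_iff]
  simp [h1, h2, adjMatrix_ofSigns_inl_inr hM, adjMatrix_ofSigns_inr_inl hM]

/-- The equations on `β` determine an eigenvector from its part `c` on `α`, as `μ⁻¹ Mᵀ c`; the
equations on `α` then hold for every `c`, because `M Mᵀ = μ² I`. -/
theorem multiplicity_ofSigns [Fintype α] (hM : OrthogonalSigns M) {μ : ℝ} (hμ0 : μ ≠ 0)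
    (hμ : (Fintype.card β : ℝ) = μ ^ 2) : (ofSigns M).multiplicity μ = Fintype.card α := by
  classical
  let ψ : (α → ℝ) →ₗ[ℝ] (α ⊕ β → ℝ) :=
    { toFun := fun c => Sum.elim c fun b => μ⁻¹ * ∑ a, (M a b : ℝ) * c a
      map_add' := fun c d => by
        ext (a | b)
        · rfl
        · simp [mul_add, Finset.sum_add_distrib]
      map_smul' := fun r c => by
        ext (a | b)
        · rfl
        · simp only [Sum.elim_inr, Pi.smul_apply, smul_eq_mul, RingHom.id_apply]
          simp_rw [mul_left_comm _ r, ← Finset.mul_sum]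
          ring }
  have hinj : Function.Injective ψ := fun c d h => funext fun a => congrFun h (.inl a)
  have hrange : LinearMap.range ψ = Module.End.eigenspace (ofSigns M).adjOp μ := by
    ext x
    rw [mem_eigenspace_ofSigns_iff hM, LinearMap.mem_range]
    constructor
    · rintro ⟨c, rfl⟩
      refine ⟨fun a => ?_, fun b => ?_⟩
      · have hdot : ∀ a', ∑ b, (M a b : ℝ) * M a' b = if a' = a then μ ^ 2 else 0 := by
          intro a'
          split_ifs with h
          · subst h
            have : ∀ b, (M a' b : ℝ) * M a' b = 1 := fun b => by exact_mod_cast hM.mul_self a' b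
            simp [this, hμ]
          · exact_mod_cast hM.orthogonal a a' (Ne.symm h)
        calc ∑ b, (M a b : ℝ) * (μ⁻¹ * ∑ a', (M a' b : ℝ) * c a')
            = μ⁻¹ * ∑ a', (∑ b, (M a b : ℝ) * M a' b) * c a' := by
              simp_rw [mul_left_comm _ μ⁻¹, ← Finset.mul_sum, Finset.sum_mul, Finset.mul_sum]
              rw [Finset.sum_comm]
              simp_rw [mul_assoc]
          _ = μ * c a := by
              simp [hdot]
              field_simp
      · change _ = μ * (μ⁻¹ * _)
        rw [mul_inv_cancel_left₀ hμ0]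
        rfl
    · rintro ⟨-, h⟩
      refine ⟨fun a => x (.inl a), ?_⟩
      ext (a | b)
      · rfl
      · change μ⁻¹ * _ = _
        rw [h b, inv_mul_cancel_left₀ hμ0]
  rw [multiplicity, ← hrange, LinearMap.finrank_range_of_inj hinj,
    Module.finrank_fintype_fun_eq_card]

theorem ofSigns_hasStarComplement [Fintype α] [Nonempty α] (hM : OrthogonalSigns M) {μ : ℝ}
    (hμ0 : μ ≠ 0) {s : ℕ} (hs : Fintype.card β = s) (hμ : (s : ℝ) = μ ^ 2) :
    (ofSigns M).HasStarComplement (edgeless (Fin s)) μ := by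
  classical
  have hm := multiplicity_ofSigns hM hμ0 (by rw [hs, hμ])
  have hE : ∀ x y : ((Set.range Sum.inl)ᶜ : Set (α ⊕ β)),
      ¬ ((ofSigns M).induce (Set.range Sum.inl)ᶜ).graph.Adj x y := by
    rintro ⟨a | b, hx⟩ ⟨a' | b', hy⟩
    · exact (hx ⟨a, rfl⟩).elim
    · exact (hx ⟨a, rfl⟩).elim
    · exact (hy ⟨a', rfl⟩).elim
    · simp [induce, ofSigns]
  have hc : Nat.card ((Set.range Sum.inl)ᶜ : Set (α ⊕ β)) = s := by
    have hr : ((Set.range Sum.inl)ᶜ : Set (α ⊕ β)) = Sum.inr '' Set.univ := by simp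
    rw [hr, Nat.card_coe_set_eq, Set.ncard_image_of_injective _ Sum.inr_injective, Set.ncard_univ,
      Nat.card_eq_fintype_card, hs]
  refine ⟨Set.range Sum.inl, ⟨?_, ?_, ?_⟩, isomorphic_edgeless _ hE hc⟩
  · rw [HasEigenvalue, Module.End.HasEigenvalue, Module.End.HasUnifEigenvalue]
    intro hbot
    have : (ofSigns M).multiplicity μ = 0 := by
      rw [multiplicity]
      exact Submodule.finrank_eq_zero.mpr hbot
    rw [hm] at this
    exact Fintype.card_ne_zero this
  · rw [hm, ← Set.image_univ, Set.ncard_image_of_injective _ Sum.inl_injective, Set.ncard_univ,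
      Nat.card_eq_fintype_card]
  · exact not_hasEigenvalue_of_graph_eq_bot _ hE hμ0

end CompleteBipartite

/-! ### The maximum order. -/

theorem mem_bipartiteOrders_of_orthogonalSigns {s k : ℕ} {M : Fin k → Fin s → ℤ} {μ : ℝ}
    (hM : OrthogonalSigns M) (hk : 0 < k) (hs : 0 < s) (hμ : (s : ℝ) = μ ^ 2) :
    s + k ∈ bipartiteOrders.{u} (edgeless (Fin s)) μ := by
  have hμ0 : μ ≠ 0 := by
    rintro rfl
    simp at hμ
    omega
  have : Nonempty (ULift.{u} (Fin k)) := ⟨⟨⟨0, hk⟩⟩⟩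
  have hM' := hM.comp (ι' := ULift.{u} (Fin k)) (κ' := ULift.{u} (Fin s)) ULift.down
    ULift.down_injective Equiv.ulift
  refine ⟨ULift.{u} (Fin k) ⊕ ULift.{u} (Fin s), inferInstance,
    ofSigns fun i j => M i.down j.down, ?_, ?_, ?_⟩
  · simp [add_comm]
  · exact ⟨SimpleGraph.Coloring.mk (fun v => if v.isLeft then 0 else 1) fun {x y} h => by
      rcases x with a | b <;> rcases y with a' | b' <;> simp_all [ofSigns]⟩
  · exact ofSigns_hasStarComplement hM' hμ0 (by simp) hμ

theorem isGreatest_bipartiteOrders {s k : ℕ} {M : Fin k → Fin s → ℤ} {μ : ℝ}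
    (hM : OrthogonalSigns M) (hk : 0 < k) (hs : 0 < s) (hμ : (s : ℝ) = μ ^ 2)
    (hmax : ∀ (l : ℕ) (N : Fin l → Fin s → ℤ), OrthogonalSigns N → l ≤ k) :
    IsGreatest (bipartiteOrders.{u} (edgeless (Fin s)) μ) (s + k) := by
  refine ⟨mem_bipartiteOrders_of_orthogonalSigns hM hk hs hμ, ?_⟩
  rintro n ⟨V, _, G, rfl, hG, h⟩
  obtain ⟨l, N, hN, hV⟩ := h.exists_orthogonalSigns hs hμ hG
  rw [hV]
  exact Nat.add_le_add_left (hmax l N hN) s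

end SignedGraph

theorem mainTheorem1 (s : ℕ) (μ : ℝ) (hsμ : (s : ℝ) = μ ^ 2) (hs : 2 ≤ s) :
    (Odd s →
      IsGreatest (SignedGraph.bipartiteOrders.{u} (SignedGraph.edgeless (Fin s)) μ) (s + 1)) ∧
    (s % 4 = 2 →
      IsGreatest (SignedGraph.bipartiteOrders.{u} (SignedGraph.edgeless (Fin s)) μ) (s + 2)) ∧
    (s ∈ hadamardOrders →
      IsGreatest (SignedGraph.bipartiteOrders.{u} (SignedGraph.edgeless (Fin s)) μ) (2 * s)) := by
  have hs0 : 0 < s := by omega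
  refine ⟨fun hodd => ?_, fun h2 => ?_, fun hH => ?_⟩
  · refine SignedGraph.isGreatest_bipartiteOrders (M := fun _ _ => 1)
      ⟨fun _ _ => Or.inl rfl, fun i j h => (h (Subsingleton.elim i j)).elim⟩ one_pos hs0 hsμ
      fun l N hN => ?_
    by_contra! hl
    have := hN.even_card (a := ⟨0, by omega⟩) (b := ⟨1, hl⟩) (by simp)
    rw [Fintype.card_fin] at this
    exact Nat.not_even_iff_odd.mpr hodd this
  -- The all-ones vector and the alternating vector are orthogonal because `s` is even.
  · have hM : OrthogonalSigns fun (i : Fin 2) (j : Fin s) =>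
        if i = 0 then (1 : ℤ) else (-1) ^ (j : ℕ) := by
      have hsum : ∑ j : Fin s, (-1 : ℤ) ^ (j : ℕ) = 0 := by
        rw [Fin.sum_univ_eq_sum_range fun j => (-1 : ℤ) ^ j, neg_one_geom_sum,
          if_pos (Nat.even_iff.mpr (by omega))]
      refine ⟨fun i j => ?_, fun i i' h => ?_⟩
      · split_ifs
        · exact Or.inl rfl
        · exact neg_one_pow_eq_or ℤ j
      · fin_cases i <;> fin_cases i' <;> simp [hsum] at h ⊢
    refine SignedGraph.isGreatest_bipartiteOrders hM two_pos hs0 hsμ fun l N hN => ?_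
    by_contra! hl
    have := hN.four_dvd_card (a := ⟨0, by omega⟩) (b := ⟨1, by omega⟩) (c := ⟨2, hl⟩)
      (by simp) (by simp) (by simp)
    rw [Fintype.card_fin] at this
    omega
  · obtain ⟨M, hM⟩ := IsHadamardOrder.of_mem_hadamardOrders hH
    rw [two_mul]
    refine SignedGraph.isGreatest_bipartiteOrders hM hs0 hs0 hsμ fun l N hN => ?_
    have : Nonempty (Fin s) := ⟨⟨0, hs0⟩⟩
    simpa using hN.card_le_card
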